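/- Let $a,b,c$ be positive integers with $a,b>1$, and suppose that there are no non-negative integers $\alpha,l$ with $\{a,b\}=\{2^{\alpha},2l+1\}$. Let $\Gamma$ be a (finite) Abelian group of order $abc$. A $\Gamma$-magic rectangle set $\mathrm{MRS}_\Gamma(a,b;c)$ is a collection of $c$ arrays of size $a\times b$ with entries in $\Gamma$ such that every element of $\Gamma$ appears exactly once in the whole collection, all row sums of all the arrays equal one constant $\omega\in\Gamma$, and all column sums of all the arrays equal one constant $\delta\in\Gamma$. An involution of $\Gamma$ is an element $\iota\neq 0$ with $2\iota=0$, and $\mathcal{G}$ denotes the class of finite Abelian groups that have odd order or contain more than one involution. Then an $\mathrm{MRS}_\Gamma(a,b;c)$ exists if and only if $a$ and $b$ are both even or $\Gamma\in\mathcal{G}$. -/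

import Mathlib

/-- `ι` is an involution of the additive group `Γ`: an element of order `2`. -/
def IsGroupInvolution {Γ : Type*} [AddCommGroup Γ] (ι : Γ) : Prop :=
  ι ≠ 0 ∧ 2 • ι = 0

/-- Membership in the class `𝒢` of finite Abelian groups that have odd order or contain more than
one involution. -/
def InClassG (Γ : Type*) [AddCommGroup Γ] [Finite Γ] : Prop :=
  Odd (Nat.card Γ) ∨ ∃ ι₁ ι₂ : Γ, IsGroupInvolution ι₁ ∧ IsGroupInvolution ι₂ ∧ ι₁ ≠ ι₂

/-- `M` is a `Γ`-magic rectangle set `MRS_Γ(a, b; c)`: a collection of `c` arrays of size `a × b`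
with entries in `Γ`, every element of `Γ` appearing exactly once in the whole collection, all row
sums of all arrays being equal to one constant `ω`, and all column sums of all arrays being equal
to one constant `δ`. -/
structure IsMagicRectangleSet {Γ : Type*} [AddCommGroup Γ] {a b c : ℕ}
    (M : Fin c → Matrix (Fin a) (Fin b) Γ) : Prop where
  appears_once : ∀ g : Γ, ∃! p : Fin c × Fin a × Fin b, M p.1 p.2.1 p.2.2 = g
  row_sum : ∃ ω : Γ, ∀ (s : Fin c) (i : Fin a), ∑ j, M s i j = ω
  col_sum : ∃ δ : Γ, ∀ (s : Fin c) (j : Fin b), ∑ i, M s i j = δ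

/-! Necessity: if `b` is odd, summing all entries by rows gives `∑ g = (c * a) • ω`, so `b • ∑ g =
|Γ| • ω = 0`. But if `Γ` has a unique involution `ι`, then `∑ g = ι` and `b • ι = ι ≠ 0`.
Transposing handles odd `a`.

Sufficiency: blocks glue to larger arrays (`HasMRS.glue`), so sides dividing `a` and `b` suffice. If
both are even, 2 × 2 blocks exist (`hasMRS_two_by_two`). Otherwise the excluded pairs leave odd
primes `q ∣ a` and `p ∣ b`. Choose `N ≤ Γ` with `|Γ ⧸ N| = q * p`. A magic `q × p` rectangle on `Γ ⧸
N` lifts to `Γ` with constant sums (`exists_lift_magic`); adding permutations of `N` whose rows and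
columns sum to zero fills each coset once. These come from three permutations of `N` with sum zero,
which Hall's theorem yields because the elements of `N` sum to zero. -/

/-! ### Hall's theorem on differences of two enumerations -/

section Hall

variable {I G : Type*} [AddCommGroup G]

/-- The rearrangement of `exists_rearrangement`, given a set `Z` that is invariant under the
permutation `σ` solving `b (σ i) = a i₁ + a i₂ + v - a i` and separates `i₂` from `i₁`. -/
lemma exists_rearrangement_of_closed (a b : I ≃ G) {i₁ i₂ : I} (v : G)
    (σ : Equiv.Perm I) (hσ : ∀ i, b (σ i) = a i₁ + a i₂ + v - a i)
    (Z : Set I) (hZ : ∀ i, σ i ∈ Z ↔ i ∈ Z) (h₂ : i₂ ∈ Z) (h₁ : i₁ ∉ Z) :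
    ∃ a' b' : I ≃ G, b' i₁ - a' i₁ = v ∧
      ∀ i, i ≠ i₁ → i ≠ i₂ → b' i - a' i = b i - a i := by
  classical
  let τ : Equiv.Perm I := Equiv.Perm.ofSubtype (σ.subtypePerm (p := (· ∈ Z)) hZ)
  have τ_mem : ∀ i ∈ Z, τ i = σ i := fun i hi => by
    simp [τ, Equiv.Perm.ofSubtype_apply_of_mem _ hi]
  have τ_not : ∀ i ∉ Z, τ i = i := fun i hi => Equiv.Perm.ofSubtype_apply_of_not_mem _ hi
  -- With `C = a i₁ + a i₂ + v`, on `Z` away from `i₁`, `i₂` the pair `(a, b)` becomes `(C - b, C -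
  -- a)`, which keeps differences. The swap gives `i₁` the value `b (σ i₂) = a i₁ + v`.
  refine ⟨τ.symm.trans a, ((Equiv.swap i₁ i₂).trans τ).trans b, ?_, fun i hi₁ hi₂ => ?_⟩
  · have h : τ.symm i₁ = i₁ := by rw [Equiv.symm_apply_eq, τ_not _ h₁]
    simp [h, τ_mem _ h₂, hσ]
    abel
  · by_cases hi : i ∈ Z
    · have h : τ.symm i = σ.symm i := by
        rw [Equiv.symm_apply_eq, τ_mem, Equiv.apply_symm_apply]
        rw [← hZ]; simpa using hi
      have e := hσ (σ.symm i)
      rw [Equiv.apply_symm_apply] at e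
      simp [h, Equiv.swap_apply_of_ne_of_ne hi₁ hi₂, τ_mem _ hi, hσ, e]
      abel
    · have h : τ.symm i = i := by rw [Equiv.symm_apply_eq, τ_not _ hi]
      simp [h, Equiv.swap_apply_of_ne_of_ne hi₁ hi₂, τ_not _ hi]

variable [Finite G]

/-- One exchange step in Hall's theorem: two families of representatives `a`, `b` of a finite
abelian group can be rearranged so that the difference at `i₁` becomes `v` while all differences
at indices other than `i₁` and `i₂` are kept. -/
lemma exists_rearrangement (a b : I ≃ G) {i₁ i₂ : I} (hne : i₁ ≠ i₂) (v : G) :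
    ∃ a' b' : I ≃ G, b' i₁ - a' i₁ = v ∧
      ∀ i, i ≠ i₁ → i ≠ i₂ → b' i - a' i = b i - a i := by
  classical
  have : Finite I := Finite.of_equiv G a.symm
  let σ : Equiv.Perm I := (a.trans (Equiv.subLeft (a i₁ + a i₂ + v))).trans b.symm
  have hσ : ∀ i, b (σ i) = a i₁ + a i₂ + v - a i := fun i => by simp [σ]
  -- On different cycles, the cycle of `i₂` serves as `Z`. On a common cycle, swapping the values of
  -- `b` at `i₁`, `i₂` cuts it: the arc `i₂, σ i₂, …, σ^(m-1) i₂` closes up without meeting `i₁`.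
  by_cases hc : σ.SameCycle i₂ i₁
  · have hex : ∃ k : ℕ, (σ ^ k) i₂ = i₁ := by
      obtain ⟨k, -, hk⟩ := hc.exists_pow_eq'
      exact ⟨k, hk⟩
    set m := Nat.find hex
    have hmi : (σ ^ m) i₂ = i₁ := Nat.find_spec hex
    have hlt : ∀ k < m, (σ ^ k) i₂ ≠ i₁ := fun k hk => Nat.find_min hex hk
    have hm0 : m ≠ 0 := by
      intro h0
      rw [h0] at hmi
      exact hne (by simpa using hmi.symm)
    have hfix : ∀ k, k ≠ 0 → k < m → (σ ^ k) i₂ ≠ i₂ := by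
      intro k hk0 hk h
      apply hlt (m - k) (by omega)
      rw [← hmi, ← Nat.sub_add_cancel hk.le, pow_add, Equiv.Perm.mul_apply, h,
        Nat.sub_add_cancel hk.le]
    have hsw : ∀ k < m, (Equiv.swap i₁ i₂) ((σ ^ (k + 1)) i₂) = 
        if k + 1 = m then i₂ else (σ ^ (k + 1)) i₂ := by
      intro k hk
      split_ifs with h
      · rw [h, hmi, Equiv.swap_apply_left]
      · exact Equiv.swap_apply_of_ne_of_ne (hlt _ (by omega)) (hfix _ (by omega) (by omega))
    let Z : Set I := {i | ∃ k < m, (σ ^ k) i₂ = i}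
    let b₁ : I ≃ G := (Equiv.swap i₁ i₂).trans b
    let σ₁ : Equiv.Perm I := σ.trans (Equiv.swap i₁ i₂)
    have hmap : ∀ i ∈ Z, σ₁ i ∈ Z := by
      rintro _ ⟨k, hk, rfl⟩
      have e : σ₁ ((σ ^ k) i₂) = if k + 1 = m then i₂ else (σ ^ (k + 1)) i₂ := by
        rw [← hsw k hk, pow_succ']
        rfl
      rw [e]
      split_ifs with h
      · exact ⟨0, by omega, rfl⟩
      · exact ⟨k + 1, by omega, rfl⟩
    have hZ : ∀ i, σ₁ i ∈ Z ↔ i ∈ Z := by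
      intro i
      refine ⟨fun h => ?_, hmap i⟩
      have him : σ₁ '' Z = Z := Set.eq_of_subset_of_ncard_le (Set.image_subset_iff.2 hmap)
        (Set.ncard_image_of_injective _ σ₁.injective).ge
      rw [← him] at h
      obtain ⟨j, hj, hji⟩ := h
      rwa [← σ₁.injective hji]
    obtain ⟨a', b', h, h'⟩ := exists_rearrangement_of_closed (i₁ := i₁) (i₂ := i₂) a b₁ v σ₁
      (fun i => by simp [b₁, σ₁, hσ]) Z hZ ⟨0, by omega, rfl⟩
      (by rintro ⟨k, hk, h⟩; exact hlt k hk h)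
    refine ⟨a', b', h, fun i hi₁ hi₂ => ?_⟩
    rw [h' i hi₁ hi₂]
    simp [b₁, Equiv.swap_apply_of_ne_of_ne hi₁ hi₂]
  · exact exists_rearrangement_of_closed a b v σ hσ {i | σ.SameCycle i₂ i}
      (fun i => Equiv.Perm.sameCycle_apply_right) (Equiv.Perm.SameCycle.refl _ _) hc

/-- **Hall's theorem**: a family of `|G|` elements of a finite abelian group `G` with sum `0` is
the difference of two enumerations of `G`. -/
theorem exists_equiv_sub_eq [Fintype I] (e : I ≃ G) (d : I → G) (hd : ∑ i, d i = 0) :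
    ∃ a b : I ≃ G, ∀ i, b i - a i = d i := by
  classical
  have := Fintype.ofFinite G
  let i₀ : I := e.symm 0
  -- Differences are corrected one index at a time, `i₀` absorbing each error; at the end the one at
  -- `i₀` is forced, since both families sum to zero.
  have key : ∀ s : Finset I, i₀ ∉ s → ∃ a b : I ≃ G, ∀ i ∈ s, b i - a i = d i := by
    intro s
    induction s using Finset.induction_on with
    | empty => exact fun _ => ⟨e, e, by simp⟩
    | insert j s hj ih =>
      intro hi
      rw [Finset.mem_insert, not_or] at hi
      obtain ⟨a, b, hab⟩ := ih hi.2
      obtain ⟨a', b', h, h'⟩ := exists_rearrangement a b (Ne.symm hi.1) (d j)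
      refine ⟨a', b', fun i his => ?_⟩
      rcases Finset.mem_insert.1 his with rfl | his
      · exact h
      · rw [h' i (fun h => hj (h ▸ his)) (fun h => hi.2 (h ▸ his)), hab i his]
  obtain ⟨a, b, hab⟩ := key (Finset.univ.erase i₀) (by simp)
  refine ⟨a, b, fun i => ?_⟩
  by_cases hi : i = i₀
  · have hs : ∑ i, (b i - a i) = 0 := by
      rw [Finset.sum_sub_distrib, Equiv.sum_comp b (fun g => g), Equiv.sum_comp a (fun g => g),
        sub_self]
    rw [← hd, ← Finset.add_sum_erase _ _ (Finset.mem_univ i₀),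
      ← Finset.add_sum_erase _ d (Finset.mem_univ i₀), Finset.sum_congr rfl hab] at hs
    rw [hi]
    exact add_right_cancel hs
  · exact hab i (by simp [hi])

/-- A finite abelian group with vanishing total sum has three permutations adding up to `0`. -/
theorem exists_three_perms [Fintype G] (h : ∑ g : G, g = 0) :
    ∃ φ : Fin 3 → G → G, (∀ k, Function.Bijective (φ k)) ∧ ∀ g, ∑ k, φ k g = 0 := by
  obtain ⟨a, b, hab⟩ := exists_equiv_sub_eq (Equiv.refl G) (fun g => g) h
  refine ⟨![a, fun g => - b g, fun g => g], fun k => ?_, fun g => ?_⟩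
  · fin_cases k
    · exact a.bijective
    · exact (b.trans (Equiv.neg G)).bijective
    · exact Function.bijective_id
  · have h' : b g = g + a g := sub_eq_iff_eq_add.1 (hab g)
    simp [Fin.sum_univ_three, h']

end Hall

/-! ### The sum of all elements of a finite abelian group -/

lemma eq_zero_or_eq_of_mem_zmultiples {G : Type*} [AddCommGroup G] {ι x : G} (hι₂ : 2 • ι = 0)
    (hx : x ∈ AddSubgroup.zmultiples ι) : x = 0 ∨ x = ι := by
  obtain ⟨k, hk⟩ := AddSubgroup.mem_zmultiples_iff.1 hx
  have hι₂' : (2 : ℤ) • ι = 0 := by exact_mod_cast hι₂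
  rcases Int.even_or_odd' k with ⟨l, rfl | rfl⟩
  · left
    rw [← hk, mul_comm, mul_smul, hι₂', smul_zero]
  · right
    rw [← hk, add_smul, mul_comm, mul_smul, hι₂', smul_zero, zero_add, one_smul]

/-- The total sum of a finite abelian group is `0` or `ι` for any involution `ι`. -/
lemma sum_univ_eq_zero_or_eq_involution {G : Type*} [AddCommGroup G] [Fintype G] {ι : G} (hι : ι ≠ 0)
    (hι₂ : 2 • ι = 0) : ∑ g : G, g = 0 ∨ ∑ g : G, g = ι := by
  classical
  -- Modulo `ι`, pair `g` with `-g` when `2 • g ≠ 0` and with `g + ι` otherwise; each pair sums to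
  -- zero.
  have h : ((∑ g : G, g : G) : G ⧸ AddSubgroup.zmultiples ι) = 0 := by
    rw [← QuotientAddGroup.mk'_apply, map_sum]
    refine Finset.sum_involution (fun g _ => if 2 • g = 0 then g + ι else -g) ?_ ?_ ?_ ?_
    · intro g _
      by_cases h : 2 • g = 0
      · rw [if_pos h, ← map_add, ← add_assoc, ← two_nsmul, h]
        simp
      · simp [h]
    · intro g _ _
      split_ifs with h
      · simpa using hι
      · intro h'
        apply h
        rw [two_nsmul]
        nth_rewrite 1 [← h']
        simp
    · simp
    · intro g _
      by_cases h : 2 • g = 0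
      · simp [h, smul_add, hι₂, add_assoc, ← two_nsmul]
      · simp [h]
  exact eq_zero_or_eq_of_mem_zmultiples hι₂ ((QuotientAddGroup.eq_zero_iff _).1 h)

lemma sum_univ_eq_zero_of_odd {G : Type*} [AddCommGroup G] [Fintype G] (h : Odd (Nat.card G)) :
    ∑ g : G, g = 0 := by
  have h₁ : ∑ g : G, g = - ∑ g : G, g := by
    rw [← Finset.sum_neg_distrib]
    exact (Equiv.sum_comp (Equiv.neg G) (fun g => g)).symm
  have h₂ : 2 • ∑ g : G, g = 0 := by
    rw [two_nsmul]
    nth_rewrite 1 [h₁]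
    simp
  have h₃ : Nat.card G • ∑ g : G, g = 0 := card_nsmul_eq_zero'
  obtain ⟨k, hk⟩ := h
  rw [hk, add_nsmul, mul_comm, mul_nsmul', h₂] at h₃
  simpa using h₃

/-! ### Magic rectangle sets over arbitrary index types; gluing -/

open Function

/-- A `Γ`-magic rectangle set with arbitrary index types for arrays, rows and columns. -/
def HasMRS (Γ S I J : Type*) [AddCommGroup Γ] [Fintype I] [Fintype J] : Prop :=
  ∃ M : S → I → J → Γ, Bijective (fun p : S × I × J => M p.1 p.2.1 p.2.2) ∧
    (∃ ω, ∀ s i, ∑ j, M s i j = ω) ∧ ∃ δ, ∀ s j, ∑ i, M s i j = δ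

section General

variable {Γ : Type*} [AddCommGroup Γ]

lemma HasMRS.congr {S I J S' I' J' : Type*} [Fintype I] [Fintype J] [Fintype I'] [Fintype J']
    (h : HasMRS Γ S I J) (eS : S' ≃ S) (eI : I' ≃ I) (eJ : J' ≃ J) : HasMRS Γ S' I' J' := by
  obtain ⟨M, hM, ⟨ω, hω⟩, δ, hδ⟩ := h
  refine ⟨fun s i j => M (eS s) (eI i) (eJ j),
    hM.comp (eS.prodCongr (eI.prodCongr eJ)).bijective, ⟨ω, fun s i => ?_⟩, δ, fun s j => ?_⟩
  · rw [Equiv.sum_comp eJ (fun j => M (eS s) (eI i) j), hω]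
  · rw [Equiv.sum_comp eI (fun i => M (eS s) i (eJ j)), hδ]

/-- Arrays of a magic rectangle set can be glued to larger arrays. -/
lemma HasMRS.glue {S I J I' J' : Type*} [Fintype I] [Fintype J] [Fintype I'] [Fintype J']
    (h : HasMRS Γ (S × I' × J') I J) : HasMRS Γ S (I' × I) (J' × J) := by
  obtain ⟨M, hM, ⟨ω, hω⟩, δ, hδ⟩ := h
  let e : S × (I' × I) × (J' × J) ≃ (S × I' × J') × I × J :=
    { toFun := fun p => ((p.1, p.2.1.1, p.2.2.1), p.2.1.2, p.2.2.2)
      invFun := fun p => (p.1.1, (p.1.2.1, p.2.1), (p.1.2.2, p.2.2))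
      left_inv := fun _ => rfl
      right_inv := fun _ => rfl }
  refine ⟨fun s i j => M (s, i.1, j.1) i.2 j.2, hM.comp e.bijective,
    ⟨Fintype.card J' • ω, fun s i => ?_⟩, Fintype.card I' • δ, fun s j => ?_⟩
  · simp [Fintype.sum_prod_type, hω]
  · simp [Fintype.sum_prod_type, hδ]

end General

/-- Three permutations with sum `0` extend to rectangular arrays of permutations with odd sides. -/
lemma exists_perm_array {N : Type*} [AddCommGroup N] {φ : Fin 3 → N → N}
    (hφ : ∀ k, Bijective (φ k)) (hφ₀ : ∀ g, ∑ k, φ k g = 0) {I J : Type*} [Fintype I] [Fintype J]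
    {k l : ℕ} (eI : I ≃ Fin 3 ⊕ (Fin k × Bool)) (eJ : J ≃ Fin 3 ⊕ (Fin l × Bool)) :
    ∃ f : I → J → N → N, (∀ i j, Bijective (f i j)) ∧ (∀ i g, ∑ j, f i j g = 0) ∧
      ∀ j g, ∑ i, f i j g = 0 := by
  let ε : Bool → ℤ := fun β => cond β 1 (-1)
  have hε : ∀ (β : Bool) (n : Fin 3), Bijective fun g => ε β • φ n g := by
    rintro (_ | _) n
    · have h := (Equiv.neg N).bijective.comp (hφ n)
      simpa [ε, comp_def] using h
    · simpa [ε] using hφ n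
  have hφ₁ : ∀ (i : Fin 3) g, ∑ j, φ (i + j) g = 0 := fun i g => by
    rw [← hφ₀ g]; exact Equiv.sum_comp (Equiv.addLeft i) (fun n => φ n g)
  have hφ₂ : ∀ (j : Fin 3) g, ∑ i, φ (i + j) g = 0 := fun j g => by
    rw [← hφ₀ g]; exact Equiv.sum_comp (Equiv.addRight j) (fun n => φ n g)
  -- A circulant 3 × 3 core, bordered by rows and columns in opposite-sign pairs; the corner sign is
  -- the product of the two border signs.
  let F : Fin 3 ⊕ (Fin k × Bool) → Fin 3 ⊕ (Fin l × Bool) → N → N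
    | .inl i, .inl j => φ (i + j)
    | .inl i, .inr y => fun g => ε y.2 • φ i g
    | .inr x, .inl j => fun g => ε x.2 • φ j g
    | .inr x, .inr y => fun g => ε (x.2 == y.2) • φ 0 g
  refine ⟨fun i j => F (eI i) (eJ j), fun i j => ?_, fun i g => ?_, fun j g => ?_⟩
  · change Bijective (F (eI i) (eJ j))
    rcases eI i with i | x <;> rcases eJ j with j | y
    · exact hφ _
    · exact hε _ _
    · exact hε _ _
    · exact hε _ _
  · rw [Equiv.sum_comp eJ (fun j => F (eI i) j g), Fintype.sum_sum_type]
    rcases eI i with i | ⟨x, β⟩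
    · simp [F, hφ₁, Fintype.sum_prod_type, ε]
    · cases β <;> simp [F, hφ₀, Fintype.sum_prod_type, ε]
  · rw [Equiv.sum_comp eI (fun i => F i (eJ j) g), Fintype.sum_sum_type]
    rcases eJ j with j | ⟨y, β⟩
    · simp [F, hφ₂, Fintype.sum_prod_type, ε]
    · cases β <;> simp [F, hφ₀, Fintype.sum_prod_type, ε]

/-! ### Lifting from a quotient -/

section Lift

variable {Γ : Type*} [AddCommGroup Γ] (N : AddSubgroup Γ) {I J : Type*} [Fintype I] [Fintype J]

/-- A magic rectangle of `Γ ⧸ N` lifts to a rectangle over `Γ` with constant row and column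
sums, as soon as its row and column constants lift compatibly. -/
lemma exists_lift_magic [Nonempty I] [Nonempty J] (h : I → J → Γ ⧸ N) (r d : Γ)
    (hr : ∀ i, ∑ j, h i j = r) (hd : ∀ j, ∑ i, h i j = d)
    (hrd : Fintype.card I • r = Fintype.card J • d) :
    ∃ x : I → J → Γ, (∀ i j, (x i j : Γ ⧸ N) = h i j) ∧ (∀ i, ∑ j, x i j = r) ∧
      ∀ j, ∑ i, x i j = d := by
  classical
  choose x hx using fun i j => QuotientAddGroup.mk_surjective (h i j)
  obtain ⟨i₀⟩ := ‹Nonempty I›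
  obtain ⟨j₀⟩ := ‹Nonempty J›
  set α : I → Γ := fun i => r - ∑ j, x i j with hα
  set β : J → Γ := fun j => d - ∑ i, x i j with hβ
  have hαβ : ∑ i, α i = ∑ j, β j := by
    simp only [hα, hβ, Finset.sum_sub_distrib, Finset.sum_const, Finset.card_univ, hrd]
    rw [Finset.sum_comm]
  have hα₀ : ∀ i, (α i : Γ ⧸ N) = 0 := fun i => by
    simp only [hα, QuotientAddGroup.mk_sub]
    rw [← QuotientAddGroup.mk'_apply, ← QuotientAddGroup.mk'_apply, map_sum]
    simp [hx, hr]
  have hβ₀ : ∀ j, (β j : Γ ⧸ N) = 0 := fun j => by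
    simp only [hβ, QuotientAddGroup.mk_sub]
    rw [← QuotientAddGroup.mk'_apply, ← QuotientAddGroup.mk'_apply, map_sum]
    simp [hx, hd]
  have ht₀ : ((∑ i, α i : Γ) : Γ ⧸ N) = 0 := by
    rw [← QuotientAddGroup.mk'_apply, map_sum]
    simp [hα₀]
  -- The defects `α`, `β` lie in `N`: put `α` into column `j₀` and `β` into row `i₀`, and subtract
  -- their common total at the crossing.
  refine ⟨fun i j => x i j + ((if j = j₀ then α i else 0) + (if i = i₀ then β j else 0) -
    if i = i₀ then if j = j₀ then ∑ i, α i else 0 else 0), fun i j => ?_, fun i => ?_,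
    fun j => ?_⟩
  · dsimp only
    split_ifs <;> simp [hx, hα₀, hβ₀, ht₀]
  · simp only [Finset.sum_add_distrib, Finset.sum_sub_distrib, Finset.sum_ite_eq',
      Finset.mem_univ, if_true]
    by_cases hi : i = i₀
    · rw [hαβ]
      simp [hi, hα]
    · simp [hi, hα]
  · simp only [Finset.sum_add_distrib, Finset.sum_sub_distrib, Finset.sum_ite_eq',
      Finset.mem_univ, if_true]
    by_cases hj : j = j₀
    · simp [hj, hβ]
    · simp [hj, hβ]

/-- Combining a bijective lift of a magic rectangle of `Γ ⧸ N` with an array of permutations of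
`N` gives a magic rectangle set. -/
lemma hasMRS_of_lift (x : I → J → Γ) (r d : Γ)
    (hx : Bijective fun p : I × J => (x p.1 p.2 : Γ ⧸ N))
    (hr : ∀ i, ∑ j, x i j = r) (hd : ∀ j, ∑ i, x i j = d) (f : I → J → N → N)
    (hf : ∀ i j, Bijective (f i j)) (hfr : ∀ i g, ∑ j, f i j g = 0)
    (hfd : ∀ j g, ∑ i, f i j g = 0) : HasMRS Γ N I J := by
  refine ⟨fun s i j => x i j + f i j s, ⟨?_, fun g => ?_⟩, ⟨r, fun s i => ?_⟩, d, fun s j => ?_⟩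
  · rintro ⟨s, i, j⟩ ⟨s', i', j'⟩ h
    have h₁ : (i, j) = (i', j') := by
      apply hx.1
      have := congrArg (QuotientAddGroup.mk : Γ → Γ ⧸ N) h
      simpa [(QuotientAddGroup.eq_zero_iff _).2 (f i j s).2,
        (QuotientAddGroup.eq_zero_iff _).2 (f i' j' s').2] using this
    obtain ⟨rfl, rfl⟩ := Prod.mk.inj h₁
    have h₂ : s = s' := (hf i j).1 (Subtype.ext (add_left_cancel h))
    rw [h₂]
  · obtain ⟨⟨i, j⟩, hij⟩ := hx.2 (g : Γ ⧸ N)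
    have hm : -x i j + g ∈ N := QuotientAddGroup.eq.1 hij
    obtain ⟨s, hs⟩ := (hf i j).2 ⟨_, hm⟩
    exact ⟨(s, i, j), by simp [hs]⟩
  · rw [Finset.sum_add_distrib, hr, ← AddSubgroup.val_finsetSum, hfr]
    simp
  · rw [Finset.sum_add_distrib, hd, ← AddSubgroup.val_finsetSum, hfd]
    simp

end Lift

/-! ### Magic rectangles in groups of order `q * p` for odd primes -/

lemma ZMod.two_ne_zero_of_ne_two (p : ℕ) [hp : Fact p.Prime] (h : p ≠ 2) : (2 : ZMod p) ≠ 0 := by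
  intro h2
  have : ((2 : ℕ) : ZMod p) = 0 := by exact_mod_cast h2
  rw [ZMod.natCast_eq_zero_iff] at this
  exact h ((Nat.prime_dvd_prime_iff_eq hp.out Nat.prime_two).1 this)

/-- An even nowhere vanishing function between prime fields of odd characteristic with vanishing
total sum. -/
lemma exists_even_weights (p q : ℕ) [Fact p.Prime] [Fact q.Prime] (hp : p ≠ 2) (hq : q ≠ 2) :
    ∃ ε : ZMod p → ZMod q, (∀ j, ε j ≠ 0) ∧ (∀ j, ε (-j) = ε j) ∧ ∑ j, ε j = 0 := by
  have hp2 := ZMod.two_ne_zero_of_ne_two p hp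
  have hq2 := ZMod.two_ne_zero_of_ne_two q hq
  -- The weight is `u` at `0`, `w` at `±1` and `1` at the other `p - 3` points. The choice `w = 1`
  -- works unless it forces `u = 0`.
  obtain ⟨w, u, hw, hu, hwu⟩ : ∃ w u : ZMod q, w ≠ 0 ∧ u ≠ 0 ∧ u + 2 * w = 3 - p := by
    by_cases ht : (3 - p : ZMod q) = 2
    · refine ⟨-1, 4, by simp, ?_, by rw [ht]; norm_num⟩
      have : (4 : ZMod q) = 2 * 2 := by norm_num
      rw [this]
      exact mul_ne_zero hq2 hq2
    · exact ⟨1, 3 - p - 2, one_ne_zero, sub_ne_zero.2 ht, by ring⟩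
  have h11 : (1 : ZMod p) ≠ -1 := by
    intro h
    apply hp2
    rw [← one_add_one_eq_two]
    nth_rewrite 1 [h]
    simp
  refine ⟨fun j => 1 + (if j = 0 then u - 1 else 0) + (if j = 1 then w - 1 else 0) +
    (if j = -1 then w - 1 else 0), fun j => ?_, fun j => ?_, ?_⟩
  · by_cases h0 : j = 0
    · simp [h0, hu, eq_comm]
    by_cases h1 : j = 1
    · simp [h1, hw, h11]
    by_cases h2 : j = -1
    · simp [h2, hw, h11.symm]
    simp [h0, h1, h2]
  · have h : -j = 1 ↔ j = -1 := neg_eq_iff_eq_neg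
    simp only [neg_eq_zero, neg_inj, h]
    ring
  · simp only [Finset.sum_add_distrib, Finset.sum_ite_eq', Finset.mem_univ, if_true]
    simp
    linear_combination hwu

/-- A group whose order is a product of two distinct primes is a product of prime fields. -/
lemma exists_addEquiv_zmod_prod {H : Type*} [AddCommGroup H] [Finite H] {p q : ℕ}
    [hp : Fact p.Prime] [hq : Fact q.Prime] (hpq : p ≠ q) (hH : Nat.card H = q * p) :
    Nonempty (ZMod q × ZMod p ≃+ H) := by
  obtain ⟨x, hx⟩ := exists_prime_addOrderOf_dvd_card' (G := H) p (hH ▸ Dvd.intro_left _ rfl)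
  obtain ⟨y, hy⟩ := exists_prime_addOrderOf_dvd_card' (G := H) q (hH ▸ Dvd.intro _ rfl)
  have hco : Nat.Coprime q p := (Nat.coprime_primes hq.out hp.out).2 hpq.symm
  have ho : addOrderOf (y + x) = Nat.card H := by
    rw [(AddCommute.all y x).addOrderOf_add_eq_mul_addOrderOf_of_coprime (by rwa [hx, hy]), hx,
      hy, hH]
  have hc : IsAddCyclic H := isAddCyclic_of_addOrderOf_eq_card _ ho
  have e := zmodAddCyclicAddEquiv hc
  rw [hH] at e
  exact ⟨(ZMod.chineseRemainder hco).symm.toAddEquiv.trans e⟩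

/-- Every group whose order is a product of two distinct odd primes has a magic rectangle. -/
lemma exists_magic_of_ne {H : Type*} [AddCommGroup H] [Finite H] {p q : ℕ}
    [Fact p.Prime] [Fact q.Prime] (hp : p ≠ 2) (hq : q ≠ 2) (hpq : p ≠ q)
    (hH : Nat.card H = q * p) :
    ∃ h : ZMod q → ZMod p → H, Bijective (fun x : ZMod q × ZMod p => h x.1 x.2) ∧
      (∀ i, ∑ j, h i j = 0) ∧ ∀ j, ∑ i, h i j = 0 := by
  obtain ⟨ψ⟩ := exists_addEquiv_zmod_prod hpq hH
  obtain ⟨ε, hε, hε', hε₀⟩ := exists_even_weights p q hp hq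
  obtain ⟨c, hc, -, hc₀⟩ := exists_even_weights q p hq hp
  have hrow : ∀ i, ∑ j, c (ε j * i) * j = 0 := by
    intro i
    have h : ∑ j, c (ε j * i) * j = - ∑ j, c (ε j * i) * j := by
      rw [← Finset.sum_neg_distrib, ← Equiv.sum_comp (Equiv.neg (ZMod p))]
      simp [hε']
    have h2 : 2 * ∑ j, c (ε j * i) * j = 0 := by linear_combination h
    exact (mul_eq_zero.1 h2).resolve_left (ZMod.two_ne_zero_of_ne_two p hp)
  -- In rows, `∑ ε = 0` kills the first coordinate and evenness of `ε` the second. In columns, `∑ i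
  -- = 0` kills the first, and substituting `i ↦ ε j * i` reduces the second to `∑ c = 0`.
  refine ⟨fun i j => ψ (ε j * i, c (ε j * i) * j), ψ.bijective.comp ?_, fun i => ?_,
    fun j => ?_⟩
  · rw [← Finite.injective_iff_bijective]
    rintro ⟨i, j⟩ ⟨i', j'⟩ h
    simp only [Prod.mk.injEq] at h ⊢
    obtain ⟨h₁, h₂⟩ := h
    rw [h₁] at h₂
    have hj := mul_left_cancel₀ (hc _) h₂
    rw [hj] at h₁
    exact ⟨mul_left_cancel₀ (hε _) h₁, hj⟩
  · rw [← map_sum, ← map_zero ψ]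
    congr 1
    ext
    · simp [Prod.fst_sum, ← Finset.sum_mul, hε₀]
    · simp [Prod.snd_sum, hrow]
  · rw [← map_sum, ← map_zero ψ]
    congr 1
    ext
    · have hodd : Odd (Nat.card (ZMod q)) := by
        simpa using (Fact.out : q.Prime).odd_of_ne_two hq
      rw [Prod.fst_sum, ← Finset.mul_sum, sum_univ_eq_zero_of_odd hodd, mul_zero]
      rfl
    · have : ∑ i, c (ε j * i) * j = ∑ i, c i * j :=
        Equiv.sum_comp (Equiv.mulLeft₀ _ (hε j)) (fun i => c i * j)
      simp [Prod.snd_sum, this, ← Finset.sum_mul, hc₀]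

/-- Every group whose order is the square of an odd prime has a magic square. -/
lemma exists_magic_square {H : Type*} [AddCommGroup H] [Finite H] {p : ℕ}
    [hp : Fact p.Prime] (hp2 : p ≠ 2) (hH : Nat.card H = p * p) :
    ∃ (h : ZMod p → ZMod p → H) (r : H), Bijective (fun x : ZMod p × ZMod p => h x.1 x.2) ∧
      (∀ i, ∑ j, h i j = r) ∧ ∀ j, ∑ i, h i j = r := by
  obtain ⟨x, hx⟩ := exists_prime_addOrderOf_dvd_card' (G := H) p (hH ▸ Dvd.intro_left _ rfl)
  set A := AddSubgroup.zmultiples x with hA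
  have hcA : Nat.card A = p := by rw [hA, Nat.card_zmultiples, hx]
  have hcQ : Nat.card (H ⧸ A) = p := by
    have := A.card_eq_card_quotient_mul_card_addSubgroup
    rw [hH, hcA] at this
    exact (Nat.eq_of_mul_eq_mul_right hp.out.pos this).symm
  obtain ⟨τ⟩ : Nonempty (ZMod p ≃ A) := 
    Finite.card_eq.1 (by rw [hcA, Nat.card_zmod])
  obtain ⟨σ⟩ : Nonempty (ZMod p ≃ H ⧸ A) := 
    Finite.card_eq.1 (by rw [hcQ, Nat.card_zmod])
  -- Since 2 is invertible, `(i + j, i - j)` determines `(i, j)`; along any row or column each of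
  -- the two runs over all of `ZMod p`.
  refine ⟨fun i j => (σ (i + j)).out + τ (i - j), ∑ k, (σ k).out + ∑ k, (τ k : H), ?_,
    fun i => ?_, fun j => ?_⟩
  · rw [Nat.bijective_iff_injective_and_card]
    refine ⟨?_, by simp [hH]⟩
    rintro ⟨i, j⟩ ⟨i', j'⟩ h
    have h₁ : i + j = i' + j' := by
      apply σ.injective
      have := congrArg (QuotientAddGroup.mk : H → H ⧸ A) h
      simpa [(QuotientAddGroup.eq_zero_iff _).2 (τ (i - j)).2,
        (QuotientAddGroup.eq_zero_iff _).2 (τ (i' - j')).2] using this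
    simp only [h₁, add_right_inj, SetLike.coe_eq_coe, EmbeddingLike.apply_eq_iff_eq] at h
    have h2 := ZMod.two_ne_zero_of_ne_two p hp2
    have hi : i = i' := mul_left_cancel₀ h2 (by linear_combination h₁ + h)
    have hj : j = j' := mul_left_cancel₀ h2 (by linear_combination h₁ - h)
    rw [hi, hj]
  · rw [Finset.sum_add_distrib]
    congr 1
    · exact Equiv.sum_comp (Equiv.addLeft i) fun k => (σ k).out
    · exact Equiv.sum_comp (Equiv.subLeft i) fun k => (τ k : H)
  · rw [Finset.sum_add_distrib]
    congr 1
    · exact Equiv.sum_comp (Equiv.addRight j) fun k => (σ k).out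
    · exact Equiv.sum_comp (Equiv.subRight j) fun k => (τ k : H)

/-! ### Sets of 2 × 2 blocks -/

/-- A fixed-point-free involution has a system of representatives for its orbits. -/
lemma exists_involution_representatives {X : Type*} [Finite X] (τ : X → X) (hτ : Involutive τ)
    (hfix : ∀ x, τ x ≠ x) :
    ∃ S : Set X, (∀ x, x ∈ S ∨ τ x ∈ S) ∧ Nat.card X = Nat.card S * 2 := by
  obtain ⟨n, ⟨e⟩⟩ := Finite.exists_equiv_fin X
  let S : Set X := {x | e x < e (τ x)}
  have hS : ∀ x, τ x ∈ S ↔ x ∉ S := fun x => by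
    have hne : e x ≠ e (τ x) := fun h => hfix x (e.injective h).symm
    simp only [S, Set.mem_ofPred_eq, hτ x, not_lt]
    exact ⟨le_of_lt, fun h => lt_of_le_of_ne h hne.symm⟩
  have him : τ '' S = Sᶜ := by
    rw [hτ.image_eq_preimage_symm]
    ext x
    exact hS x
  refine ⟨S, fun x => ?_, ?_⟩
  · rw [hS]
    exact em _
  · have h := Set.ncard_add_ncard_compl S
    rw [← him, Set.ncard_image_of_injective _ hτ.injective] at h
    rw [← h, ← Nat.card_coe_set_eq, mul_two]

/-- Let `A = {0, ι}` with `ι` of order 2. As `Γ ⧸ A` has even order, some `w` is not a double there,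
so `y ↦ w - y` has no fixed point. For one `y` from each orbit, lifted to `Γ`, the block with rows
`(y, w - y)` and `(w - y + ι, y + ι)` fills two cosets, with row sums `w` and column sums `w + ι`.
-/
lemma hasMRS_two_by_two {Γ : Type*} [AddCommGroup Γ] [Finite Γ] {n : ℕ}
    (h : Nat.card Γ = 4 * n) : HasMRS Γ (Fin n) Bool Bool := by
  classical
  have hp : Fact (Nat.Prime 2) := ⟨Nat.prime_two⟩
  obtain ⟨ι, hι⟩ := exists_prime_addOrderOf_dvd_card' (G := Γ) 2 (h ▸ ⟨2 * n, by ring⟩)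
  set A := AddSubgroup.zmultiples ι with hA
  have hcA : Nat.card A = 2 := by rw [hA, Nat.card_zmultiples, hι]
  have hι₂ : 2 • ι = 0 := hι ▸ addOrderOf_nsmul_eq_zero ι
  have hmem : ∀ x, x ∈ A → x = 0 ∨ x = ι := fun x hx => eq_zero_or_eq_of_mem_zmultiples hι₂ hx
  have hcQ : Nat.card (Γ ⧸ A) = 2 * n := by
    have := A.card_eq_card_quotient_mul_card_addSubgroup
    rw [hcA] at this
    omega
  obtain ⟨ω, hω⟩ : ∃ ω : Γ ⧸ A, ∀ y, ω - y ≠ y := by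
    obtain ⟨κ, hκ⟩ := exists_prime_addOrderOf_dvd_card' (G := Γ ⧸ A) 2 (hcQ ▸ ⟨n, rfl⟩)
    by_contra! hcon
    have hsurj : Surjective fun y : Γ ⧸ A => 2 • y := fun ω => by
      obtain ⟨y, hy⟩ := hcon ω
      exact ⟨y, (two_nsmul y).trans (sub_eq_iff_eq_add.1 hy).symm⟩
    have hκ₀ : κ = 0 := Finite.injective_iff_surjective.2 hsurj (by
      simpa using hκ ▸ addOrderOf_nsmul_eq_zero κ)
    rw [hκ₀, addOrderOf_zero] at hκ
    omega
  obtain ⟨w, rfl⟩ := QuotientAddGroup.mk_surjective ω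
  obtain ⟨S, hS, hcS⟩ := exists_involution_representatives (fun y : Γ ⧸ A => w - y)
    (fun y => by simp) hω
  obtain ⟨e⟩ : Nonempty (Fin n ≃ S) := Finite.card_eq.1 (by rw [Nat.card_fin]; omega)
  refine HasMRS.congr (S := S) ⟨fun s i j => (if i = j then s.1.out else w - s.1.out) +
    if i then ι else 0, ?_, ⟨w, ?_⟩, w + ι, ?_⟩ e (Equiv.refl _) (Equiv.refl _)
  · rw [Nat.bijective_iff_surjective_and_card]
    refine ⟨fun g => ?_, by rw [Nat.card_coe_set_eq] at hcS; simp; omega⟩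
    rcases hS g with hg | hg
    · have := hmem (g - (g : Γ ⧸ A).out) (by rw [← QuotientAddGroup.eq_zero_iff]; simp)
      rcases this with h | h
      · exact ⟨(⟨g, hg⟩, false, false), by simpa using (sub_eq_zero.1 h).symm⟩
      · exact ⟨(⟨g, hg⟩, true, true), by simp [← h]⟩
    · have := hmem (g - (w - (w - g : Γ ⧸ A).out)) (by
        rw [← QuotientAddGroup.eq_zero_iff]; simp)
      rcases this with h | h
      · exact ⟨(⟨_, hg⟩, false, true), by simpa using (sub_eq_zero.1 h).symm⟩
      · exact ⟨(⟨_, hg⟩, true, false), by simp [← h]⟩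
  · rintro s (_ | _)
    · simp
    · simp only [Fintype.sum_bool, if_true, Bool.true_eq_false, if_false]
      rw [show ∀ x y : Γ, x + ι + (y + ι) = y + x + 2 • ι from fun x y => by abel, hι₂]
      simp
  · rintro s (_ | _)
    · simp
      abel
    · simp
      abel

/-! ### Assembling the constructions -/

/-- Converse of Lagrange: Cauchy's theorem gives prime orders, and products come from pulling back a
subgroup of a quotient. -/
lemma exists_addSubgroup_card_eq (d : ℕ) : ∀ {G : Type*} [AddCommGroup G] [Finite G],
    d ∣ Nat.card G → ∃ N : AddSubgroup G, Nat.card N = d := by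
  induction d using Nat.recOnMul with
  | zero =>
    intro G _ _ h
    exact absurd (zero_dvd_iff.1 h) Nat.card_pos.ne'
  | one => exact fun _ => ⟨⊥, by simp⟩
  | prime p hp =>
    intro G _ _ h
    have : Fact p.Prime := ⟨hp⟩
    obtain ⟨x, hx⟩ := exists_prime_addOrderOf_dvd_card' (G := G) p h
    exact ⟨AddSubgroup.zmultiples x, by rw [Nat.card_zmultiples, hx]⟩
  | mul a b iha ihb =>
    intro G _ _ h
    obtain ⟨A, hA⟩ := iha (dvd_of_mul_right_dvd h)
    have hcard := A.card_eq_card_quotient_mul_card_addSubgroup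
    have hb : b ∣ Nat.card (G ⧸ A) := by
      rw [hcard, hA, mul_comm] at h
      exact Nat.dvd_of_mul_dvd_mul_right (hA ▸ Nat.card_pos) h
    obtain ⟨B, hB⟩ := ihb hb
    refine ⟨B.comap (QuotientAddGroup.mk' A), ?_⟩
    have h₁ := (B.comap (QuotientAddGroup.mk' A)).card_mul_index
    rw [AddSubgroup.index_comap_of_surjective _ (QuotientAddGroup.mk'_surjective A)] at h₁
    have h₂ := B.card_mul_index
    have h₃ : 0 < B.index := Nat.pos_of_ne_zero B.index_ne_zero_of_finite
    apply Nat.eq_of_mul_eq_mul_right h₃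
    rw [h₁, hcard, ← h₂, hA, hB]
    ring

lemma exists_isMagicRectangleSet_iff {Γ : Type*} [AddCommGroup Γ] {a b c : ℕ} :
    (∃ M : Fin c → Matrix (Fin a) (Fin b) Γ, IsMagicRectangleSet M) ↔
      HasMRS Γ (Fin c) (Fin a) (Fin b) :=
  ⟨fun ⟨M, h⟩ => ⟨M, (bijective_iff_existsUnique _).2 h.appears_once, h.row_sum, h.col_sum⟩,
    fun ⟨M, h, hr, hc⟩ => ⟨M, (bijective_iff_existsUnique _).1 h, hr, hc⟩⟩

/-- Gluing in terms of `Fin`, which reduces the side lengths to divisors. -/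
lemma HasMRS.fin_mul {Γ : Type*} [AddCommGroup Γ] {c a' b' : ℕ} {I J : Type*} [Fintype I]
    [Fintype J] (h : HasMRS Γ (Fin (c * (a' * b'))) I J) :
    HasMRS Γ (Fin c) (Fin (a' * Fintype.card I)) (Fin (b' * Fintype.card J)) := by
  have h' : HasMRS Γ (Fin c × Fin a' × Fin b') I J :=
    h.congr (((Equiv.refl _).prodCongr finProdFinEquiv).trans finProdFinEquiv) (Equiv.refl _)
      (Equiv.refl _)
  exact h'.glue.congr (Equiv.refl _)
    (finProdFinEquiv.symm.trans ((Equiv.refl _).prodCongr (Fintype.equivFin I).symm))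
    (finProdFinEquiv.symm.trans ((Equiv.refl _).prodCongr (Fintype.equivFin J).symm))

lemma HasMRS.symm {Γ S I J : Type*} [AddCommGroup Γ] [Fintype I] [Fintype J]
    (h : HasMRS Γ S I J) : HasMRS Γ S J I := by
  obtain ⟨M, hM, hr, hc⟩ := h
  exact ⟨fun s j i => M s i j,
    hM.comp ((Equiv.refl S).prodCongr (Equiv.prodComm J I)).bijective, hc, hr⟩

/-- The total sum of a finite abelian group in the class `𝒢` vanishes. -/
lemma InClassG.sum_univ_eq_zero {G : Type*} [AddCommGroup G] [Fintype G] (h : InClassG G) :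
    ∑ g : G, g = 0 := by
  rcases h with h | ⟨ι₁, ι₂, h₁, h₂, hne⟩
  · exact sum_univ_eq_zero_of_odd h
  · rcases sum_univ_eq_zero_or_eq_involution h₁.1 h₁.2 with h | h
    · exact h
    · rcases sum_univ_eq_zero_or_eq_involution h₂.1 h₂.2 with h' | h'
      · exact h'
      · exact absurd (h.symm.trans h') hne

/-- An odd multiple of an involution is itself, so `N.index • ι ∈ N` puts every involution of `G` in
`N`. -/
lemma InClassG.of_odd_index {G : Type*} [AddCommGroup G] [Finite G] (h : InClassG G)
    (N : AddSubgroup G) (hN : Odd N.index) : InClassG N := by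
  have key : ∀ ι : G, IsGroupInvolution ι → ι ∈ N := by
    intro ι hι
    obtain ⟨k, hk⟩ := hN
    have h₁ := N.nsmul_index_mem ι
    rwa [hk, add_nsmul, mul_comm, mul_nsmul', hι.2, smul_zero, zero_add, one_nsmul] at h₁
  rcases h with h | ⟨ι₁, ι₂, h₁, h₂, hne⟩
  · exact Or.inl (Odd.of_dvd_nat h N.card_addSubgroup_dvd_card)
  · exact Or.inr ⟨⟨ι₁, key _ h₁⟩, ⟨ι₂, key _ h₂⟩,
      ⟨fun h => h₁.1 (congrArg Subtype.val h), Subtype.ext h₁.2⟩,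
      ⟨fun h => h₂.1 (congrArg Subtype.val h), Subtype.ext h₂.2⟩,
      fun h => hne (congrArg Subtype.val h)⟩

lemma nonempty_zmod_equiv {p : ℕ} [hp : Fact p.Prime] (h2 : p ≠ 2) :
    ∃ k, Nonempty (ZMod p ≃ Fin 3 ⊕ (Fin k × Bool)) := by
  obtain ⟨k, hk⟩ := hp.out.odd_of_ne_two h2
  have := hp.out.two_le
  refine ⟨k - 1, Fintype.card_eq.1 ?_⟩
  simp
  omega

lemma InClassG.hasMRS_prime {Γ : Type*} [AddCommGroup Γ] [Finite Γ] (hΓ : InClassG Γ) {p q n : ℕ}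
    [hp : Fact p.Prime] [hq : Fact q.Prime] (hp2 : p ≠ 2) (hq2 : q ≠ 2)
    (hcard : Nat.card Γ = n * (q * p)) : HasMRS Γ (Fin n) (ZMod q) (ZMod p) := by
  obtain ⟨N, hN⟩ := exists_addSubgroup_card_eq n (hcard ▸ Dvd.intro _ rfl)
  have hn : 0 < n := hN ▸ Nat.card_pos
  have hindex : Nat.card (Γ ⧸ N) = q * p := by
    have := N.card_eq_card_quotient_mul_card_addSubgroup
    rw [hcard, hN, mul_comm] at this
    exact (Nat.eq_of_mul_eq_mul_right hn this).symm
  have hNG : InClassG N := hΓ.of_odd_index N (by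
    rw [AddSubgroup.index, hindex]
    exact (hq.out.odd_of_ne_two hq2).mul (hp.out.odd_of_ne_two hp2))
  have := Fintype.ofFinite N
  obtain ⟨φ, hφ, hφ₀⟩ := exists_three_perms hNG.sum_univ_eq_zero
  obtain ⟨k, ⟨eI⟩⟩ := nonempty_zmod_equiv hq2
  obtain ⟨l, ⟨eJ⟩⟩ := nonempty_zmod_equiv hp2
  obtain ⟨f, hf, hfr, hfd⟩ := exists_perm_array hφ hφ₀ eI eJ
  -- The compatibility needed for lifting is free: equal constants on a square, zero constants when
  -- `p ≠ q`.
  obtain ⟨h, r, d, hh, hr, hd, hrd⟩ : ∃ (h : ZMod q → ZMod p → Γ ⧸ N) (r d : Γ),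
      Bijective (fun x : ZMod q × ZMod p => h x.1 x.2) ∧ (∀ i, ∑ j, h i j = r) ∧
      (∀ j, ∑ i, h i j = d) ∧ Fintype.card (ZMod q) • r = Fintype.card (ZMod p) • d := by
    by_cases hpq : p = q
    · subst hpq
      obtain ⟨h, r, hh, hr, hd⟩ := exists_magic_square hp2 hindex
      obtain ⟨r, rfl⟩ := QuotientAddGroup.mk_surjective r
      exact ⟨h, r, r, hh, hr, hd, rfl⟩
    · obtain ⟨h, hh, hr, hd⟩ := exists_magic_of_ne hp2 hq2 hpq hindex
      exact ⟨h, 0, 0, hh, hr, hd, by simp⟩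
  obtain ⟨x, hx, hxr, hxd⟩ := exists_lift_magic N h r d hr hd hrd
  refine (hasMRS_of_lift N x r d (by simpa only [hx] using hh) hxr hxd f hf hfr hfd).congr
    ?_ (Equiv.refl _) (Equiv.refl _)
  exact (Finite.card_eq.1 (by rw [Nat.card_fin, hN])).some

lemma InClassG.hasMRS_of_odd_primes {Γ : Type*} [AddCommGroup Γ] [Finite Γ] (hΓ : InClassG Γ)
    {a b c p q : ℕ} (hp : p.Prime) (hp2 : p ≠ 2) (hpb : p ∣ b) (hq : q.Prime) (hq2 : q ≠ 2)
    (hqa : q ∣ a) (hcard : Nat.card Γ = a * b * c) : HasMRS Γ (Fin c) (Fin a) (Fin b) := by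
  have : Fact p.Prime := ⟨hp⟩
  have : Fact q.Prime := ⟨hq⟩
  obtain ⟨a, rfl⟩ := hqa
  obtain ⟨b, rfl⟩ := hpb
  have h := (hΓ.hasMRS_prime (n := c * (a * b)) hp2 hq2 (by rw [hcard]; ring)).fin_mul
  rw [ZMod.card, ZMod.card] at h
  rwa [mul_comm q, mul_comm p]

lemma hasMRS_of_even {Γ : Type*} [AddCommGroup Γ] [Finite Γ] {a b c : ℕ} (ha : Even a)
    (hb : Even b) (hcard : Nat.card Γ = a * b * c) : HasMRS Γ (Fin c) (Fin a) (Fin b) := by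
  obtain ⟨a, rfl⟩ := ha.two_dvd
  obtain ⟨b, rfl⟩ := hb.two_dvd
  have h := (hasMRS_two_by_two (n := c * (a * b)) (by rw [hcard]; ring)).fin_mul
  rw [Fintype.card_bool] at h
  rwa [mul_comm 2 a, mul_comm 2 b]

/-! ### Necessity -/

/-- A magic rectangle set with rows of odd length forces the group to lie in the class `𝒢`. -/
lemma HasMRS.inClassG_of_odd {Γ : Type*} [AddCommGroup Γ] [Finite Γ] {a b c : ℕ}
    (h : HasMRS Γ (Fin c) (Fin a) (Fin b)) (hb : Odd b) : InClassG Γ := by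
  have := Fintype.ofFinite Γ
  by_contra hG
  simp only [InClassG, not_or, Nat.not_odd_iff_even] at hG
  obtain ⟨he, hun⟩ := hG
  have : Fact (Nat.Prime 2) := ⟨Nat.prime_two⟩
  obtain ⟨ι, hι⟩ := exists_prime_addOrderOf_dvd_card' (G := Γ) 2 he.two_dvd
  have hι₂ : 2 • ι = 0 := hι ▸ addOrderOf_nsmul_eq_zero ι
  have hι₀ : ι ≠ 0 := by
    rintro rfl
    simp at hι
  obtain ⟨M, hM, ⟨ω, hω⟩, -⟩ := h
  have hcard : Nat.card Γ = b * (c * a) := by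
    rw [← Nat.card_congr (Equiv.ofBijective _ hM)]
    simp
    ring
  have hsum : ∑ g : Γ, g = (c * a) • ω := by
    rw [← Equiv.sum_comp (Equiv.ofBijective _ hM) (fun g => g)]
    simp [Fintype.sum_prod_type, hω, mul_nsmul']
  have hb₀ : b • ∑ g : Γ, g = 0 := by
    rw [hsum, ← mul_nsmul', ← hcard]
    exact card_nsmul_eq_zero'
  -- Outside `{0, ι}`, each `g` cancels against `-g ≠ g`.
  have hι_sum : ∑ g : Γ, g = ι := by
    classical
    rw [← Finset.sum_filter_add_sum_filter_not _ (fun g : Γ => 2 • g = 0)]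
    have h₁ : Finset.univ.filter (fun g : Γ => 2 • g = 0) = {0, ι} := by
      ext g
      simp only [Finset.mem_filter, Finset.mem_univ, true_and, Finset.mem_insert,
        Finset.mem_singleton]
      refine ⟨fun hg => ?_, ?_⟩
      · by_contra! hcon
        exact hun ⟨g, ι, ⟨hcon.1, hg⟩, ⟨hι₀, hι₂⟩, hcon.2⟩
      · rintro (rfl | rfl)
        · simp
        · exact hι₂
    have h₂ : ∑ g ∈ Finset.univ.filter (fun g : Γ => ¬ 2 • g = 0), g = 0 := by
      refine Finset.sum_involution (fun g _ => -g) (by simp) ?_ (by simp) (by simp)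
      intro g hg _ h
      rw [Finset.mem_filter] at hg
      apply hg.2
      rw [two_nsmul]
      nth_rewrite 1 [← h]
      simp
    rw [h₁, h₂, Finset.sum_pair hι₀.symm, zero_add, add_zero]
  rw [hι_sum] at hb₀
  obtain ⟨k, rfl⟩ := hb
  rw [add_nsmul, mul_comm, mul_nsmul', hι₂, smul_zero, zero_add, one_nsmul] at hb₀
  exact hι₀ hb₀

/-! ### Odd prime divisors and the conclusion -/

lemma Nat.exists_odd_prime_dvd_of_odd {n : ℕ} (hn : 1 < n) (ho : Odd n) :
    ∃ p, p.Prime ∧ p ≠ 2 ∧ p ∣ n := by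
  refine ⟨n.minFac, n.minFac_prime hn.ne', fun h => ?_, n.minFac_dvd⟩
  exact Nat.not_even_iff_odd.2 ho (even_iff_two_dvd.2 (h ▸ n.minFac_dvd))

lemma Nat.exists_odd_prime_dvd_of_ne_two_pow {n : ℕ} (hn : ∀ k, n ≠ 2 ^ k) :
    ∃ p, p.Prime ∧ p ≠ 2 ∧ p ∣ n := by
  rcases n.eq_two_pow_or_exists_odd_prime_and_dvd with ⟨k, hk⟩ | ⟨p, hp, hd, ho⟩
  · exact absurd hk (hn k)
  · exact ⟨p, hp, fun h => by subst h; exact absurd ho (by decide), hd⟩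

theorem theorem3p5 {Γ : Type*} [AddCommGroup Γ] [Finite Γ] (a b c : ℕ)
    (ha : 1 < a) (hb : 1 < b) (hcard : Nat.card Γ = a * b * c)
    (hab : ¬ ∃ α l : ℕ, ({a, b} : Set ℕ) = {2 ^ α, 2 * l + 1}) :
    (∃ M : Fin c → Matrix (Fin a) (Fin b) Γ, IsMagicRectangleSet M) ↔
      ((Even a ∧ Even b) ∨ InClassG Γ) := by
  rw [exists_isMagicRectangleSet_iff]
  constructor
  · intro h
    rcases Nat.even_or_odd a with hea | hoa
    · rcases Nat.even_or_odd b with heb | hob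
      · exact Or.inl ⟨hea, heb⟩
      · exact Or.inr (h.inClassG_of_odd hob)
    · exact Or.inr (h.symm.inClassG_of_odd hoa)
  · intro h
    by_cases he : Even a ∧ Even b
    · exact hasMRS_of_even he.1 he.2 hcard
    have hΓ : InClassG Γ := h.resolve_left he
    obtain ⟨⟨q, hq, hq2, hqa⟩, p, hp, hp2, hpb⟩ :
        (∃ q, q.Prime ∧ q ≠ 2 ∧ q ∣ a) ∧ ∃ p, p.Prime ∧ p ≠ 2 ∧ p ∣ b := by
      -- One side is odd; were the other a power of two, `{a, b}` would be an excluded pair.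
      rcases Nat.even_or_odd b with heb | ⟨l, hl⟩
      · obtain ⟨l, hl⟩ := Nat.not_even_iff_odd.1 fun hea => he ⟨hea, heb⟩
        exact ⟨Nat.exists_odd_prime_dvd_of_odd ha ⟨l, hl⟩,
          Nat.exists_odd_prime_dvd_of_ne_two_pow fun k hk =>
            hab ⟨k, l, by rw [hl, hk, Set.pair_comm]⟩⟩
      · exact ⟨Nat.exists_odd_prime_dvd_of_ne_two_pow fun k hk => hab ⟨k, l, by rw [hl, hk]⟩,
          Nat.exists_odd_prime_dvd_of_odd hb ⟨l, hl⟩⟩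
    exact hΓ.hasMRS_of_odd_primes hp hp2 hpb hq hq2 hqa hcard
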